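/- Let $b\ge 2$ be an integer and let $\mathbb T_b$ be the rooted $b$-nary tree with root $\varnothing$; write $m(\sigma)$ for the mother of a site $\sigma\ne\varnothing$. Let $\rho$ be a Borel probability measure on $[0,1]$ that has a bounded density with respect to Lebesgue measure and satisfies $\rho([1-\frac1b,1])>0$, and set $x_\star=\sup\{y\in[0,1]:\rho([y,1])>0\}$. Let $(X_\sigma)_{\sigma\in\mathbb T_b}$ be i.i.d. with law $\rho$, with joint law $\mathbb P_\rho$ and expectation $\mathbb E_\rho$. For $v>0$ put $X^{(v)}_\varnothing(0)=X_\varnothing+v$ and $X^{(v)}_\sigma(0)=X_\sigma$ for $\sigma\neq\varnothing$, and for $t\ge0$ let $$X^{(v)}_\sigma(t+1)=\begin{cases}X^{(v)}_\sigma(t)+\frac1bX^{(v)}_{m(\sigma)}(t),&\text{if }\sigma\ne\varnothing\text{ and }X^{(v)}_{m(\sigma)}(t)\ge1,\\0,&\text{otherwise, if }X^{(v)}_\sigma(t)\ge1,\\X^{(v)}_\sigma(t),&\text{otherwise.}\end{cases}$$ Let $\mathscr A^{(v)}$ be the (random) set of sites $\sigma$ that avalanche, i.e. such that for some $s<t$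 one has $X^{(v)}_\sigma(s)\neq0$ and $X^{(v)}_\sigma(t)=0$. For i.i.d. $X_1,X_2,\dots$ with law $\rho$ put $Q^{(\theta)}_0=\theta$, $Q^{(\theta)}_{n}=X_n+\frac1bQ^{(\theta)}_{n-1}$ for $n\ge1$, and $Z_n(\theta)=\mathbb P(Q^{(\theta)}_k\ge1,\ k=0,\dots,n)$. Then the limit $\mathfrak z(\rho)=\lim_{n\to\infty}Z_n(\theta)^{1/n}$ exists for all $\theta\ge1$ and does not depend on $\theta$, and the following hold. (1) $\mathfrak z(\rho)\le\frac1b$ if and only if $\mathbb P_\rho(|\mathscr A^{(v)}|=\infty)=0$ for all $v\in(0,\infty)$. In particular there is no infinite avalanche at criticality, $\mathfrak z(\rho)=\frac1b$. (2) If $\mathfrak z(\rho)>\frac1b$, then $\mathbb P_\rho(|\mathscr A^{(v)}|=\infty)>0$ for all $v\in(1-x_\star,\infty)$. (3) There is no intermediate phase: if $\mathfrak z(\rho)<\frac1b$, then $\mathbb E_\rho(|\mathscr A^{(v)}|)<\infty$ for all $v\in(0,\infty)$, while if $\mathfrak z(\rho)>\frac1b$, then $\mathbb E_\rho(|\mathscr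 A^{(v)}|)=\infty$ for all $v\in(1-x_\star,\infty)$. -/

import Mathlib

open MeasureTheory Filter Topology
open scoped ENNReal NNReal

noncomputable section

namespace Avalanche

/-- Sites of the `b`-nary rooted tree: `(σ₁, …, σ_k)` is a site of the `k`-th layer, the root is
`[]`, and the mother of `σ ≠ []` is `σ.dropLast = (σ₁, …, σ_{k-1})`. -/
abbrev Site (b : ℕ) : Type := List (Fin b)

/-- The process `X_σ^{(v)}(t)` started from the configuration `X` with the amount `v` added at the
root. A site with value at least one distributes its value evenly among its daughters and is reset
to zero. The root has no mother. -/
def process (b : ℕ) (X : Site b → ℝ) (v : ℝ) : ℕ → Site b → ℝ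
  | 0, σ => if σ = [] then X σ + v else X σ
  | t + 1, σ =>
      if σ ≠ [] ∧ 1 ≤ process b X v t σ.dropLast then
        process b X v t σ + 1 / (b : ℝ) * process b X v t σ.dropLast
      else if 1 ≤ process b X v t σ then 0
      else process b X v t σ

/-- The set of sites that have avalanched by time `t`. -/
def avalancheBy (b : ℕ) (X : Site b → ℝ) (v : ℝ) (t : ℕ) : Set (Site b) :=
  {σ | process b X v t σ = 0 ∧ ∃ s < t, process b X v s σ ≠ 0}

/-- The set of sites that ever avalanche. -/
def avalanche (b : ℕ) (X : Site b → ℝ) (v : ℝ) : Set (Site b) :=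
  ⋃ t : ℕ, avalancheBy b X v t

/-- The law of the initial configuration: i.i.d. values with distribution `ρ` at all sites. -/
def configLaw (b : ℕ) (ρ : Measure ℝ) [IsProbabilityMeasure ρ] : Measure (Site b → ℝ) :=
  Measure.infinitePi (fun _ : Site b => ρ)

/-- The probability that the avalanche is infinite. -/
def probInfinite (b : ℕ) (ρ : Measure ℝ) [IsProbabilityMeasure ρ] (v : ℝ) : ℝ≥0∞ :=
  configLaw b ρ {X | (avalanche b X v).Infinite}

/-- The expected number of sites in the avalanche. -/
def meanSize (b : ℕ) (ρ : Measure ℝ) [IsProbabilityMeasure ρ] (v : ℝ) : ℝ≥0∞ :=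
  ∫⁻ X, ((avalanche b X v).encard : ℝ≥0∞) ∂(configLaw b ρ)

/-- `Q_n^{(θ)} = X_n + X_{n-1} / b + ⋯ + X_1 / b^(n-1) + θ / b^n`, where the variable `X_{k+1}` is
the entry `X k` of the sequence. -/
def Q (b : ℕ) (X : ℕ → ℝ) (θ : ℝ) : ℕ → ℝ
  | 0 => θ
  | n + 1 => X n + 1 / (b : ℝ) * Q b X θ n

/-- `Z_n(θ)`, the probability that `Q_k^{(θ)} ≥ 1` for all `k = 0, …, n`, for i.i.d. variables with
distribution `ρ`. -/
def Z (b : ℕ) (ρ : Measure ℝ) [IsProbabilityMeasure ρ] (n : ℕ) (θ : ℝ) : ℝ :=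
  (Measure.infinitePi (fun _ : ℕ => ρ)).real {X | ∀ k ≤ n, 1 ≤ Q b X θ k}

/-- The functional `z(ρ) = lim_n Z_n(θ)^(1/n)`, taken at `θ = 1`. That the limit exists and is the
same for every `θ ≥ 1` is asserted in the theorem. -/
def zFun (b : ℕ) (ρ : Measure ℝ) [IsProbabilityMeasure ρ] : ℝ :=
  limUnder atTop (fun n : ℕ => Z b ρ n 1 ^ (1 / (n : ℝ)))

/-- The maximum of the support of `ρ`. -/
def xStar (ρ : Measure ℝ) : ℝ :=
  sSup {y : ℝ | y ∈ Set.Icc (0 : ℝ) 1 ∧ 0 < ρ (Set.Icc y 1)}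

/-- For a probability measure `ρ`: it is carried by `[0,1]`, has an essentially bounded density with
respect to Lebesgue measure on `[0,1]`, and charges `[1 - 1/b, 1]`. -/
structure MFlat (b : ℕ) (ρ : Measure ℝ) : Prop where
  bounded_density : ∃ (φ : ℝ → ℝ≥0∞) (C : ℝ≥0), Measurable φ ∧
    (∀ᵐ x ∂(volume.restrict (Set.Icc (0 : ℝ) 1)), φ x ≤ (C : ℝ≥0∞)) ∧
    ρ = (volume.restrict (Set.Icc (0 : ℝ) 1)).withDensity φ
  pos_mass : 0 < ρ (Set.Icc (1 - 1 / (b : ℝ)) 1)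

end Avalanche

end

noncomputable section

namespace Avalanche

/-! Put `T f(θ) = 1_{θ ≥ 1} E f(X + θ/b)` and `g(u) = 1 - (1 - u)^b`. Iterating `T` on the indicator
of `[1, ∞)` gives `Z_n(θ)`. Inserting `g` after the expectation gives the probability that an
avalanche from root value `θ` reaches generation `n`, because the daughters' subtrees are
independent (`configLaw_real_reaches`). The dynamics reduces to this since a site can topple only at
the time equal to its depth: almost surely the avalanche is the set of sites whose whole ancestral
path reaches the threshold (`avalanche_eq`).

`Z_n(1)` is supermultiplicative, so Fekete's lemma yields `z` and the bound `Z_n(1) ≤ z^n` for every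
`n`. Other starting points are handled by coupling (`iter_add_le`): an initial gap `δ` shrinks to
`δ/b^k`, and the bounded density makes separation at step `k` cost at most a multiple of `δ/b^k`,
which is summable.

If `z ≤ 1/b` and reaching probabilities from `1` decreased to some `c > 0`, strict concavity of `g`
would give `g(u) ≤ q b u` with `q < 1` at every step, hence `c ≤ q^n b^n Z_n(1) ≤ q^n`, a
contradiction (`tendsto_iter_one_zero`). If `z > 1/b`, some `N` has `b^N Z_N(1) > 1`; then `h =
∑_{k<N} b^k Z_k` grows under `bT` by a fixed amount, which pays for the quadratic loss in `g`, so a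
small multiple of `h` bounds all the reaching probabilities from below (`exists_iter_lower_bound`).

The mean size is `∑ b^n E Z_n(X + v)`, a series with geometric majorant below criticality; above it,
infinite avalanches already make the mean infinite. -/

/-- Iterates, started from the indicator of `[1, ∞)`, of the map sending `f` to
`θ ↦ 1_{θ ≥ 1} G (E f(X + θ / b))`. -/
def iter (b : ℕ) (ρ : Measure ℝ) (G : ℝ → ℝ) : ℕ → ℝ → ℝ
  | 0, θ => if 1 ≤ θ then 1 else 0
  | n + 1, θ => if 1 ≤ θ then G (∫ x, iter b ρ G n (x + θ / b) ∂ρ) else 0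

/-- `G` maps the unit interval to itself, is nondecreasing, and `L`-Lipschitz. -/
structure UnitLipschitz (L : ℝ) (G : ℝ → ℝ) : Prop where
  zero_le : 0 ≤ G 0
  le_one : G 1 ≤ 1
  mono : ∀ p q, 0 ≤ p → p ≤ q → q ≤ 1 → G p ≤ G q
  lip : ∀ p q, 0 ≤ p → p ≤ q → q ≤ 1 → G q - G p ≤ L * (q - p)

lemma integrable_shift {ρ : Measure ℝ} [IsProbabilityMeasure ρ] {f : ℝ → ℝ} (hf : Monotone f)
    (h0 : ∀ x, 0 ≤ f x) (h1 : ∀ x, f x ≤ 1) (c : ℝ) : Integrable (fun x => f (x + c)) ρ := by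
  refine Integrable.of_bound (C := 1) (hf.measurable.comp (by fun_prop)).aestronglyMeasurable ?_
  exact ae_of_all _ fun x => by rw [Real.norm_of_nonneg (h0 _)]; exact h1 _

lemma integral_shift_mem {ρ : Measure ℝ} [IsProbabilityMeasure ρ] {f : ℝ → ℝ} (hf : Monotone f)
    (h0 : ∀ x, 0 ≤ f x) (h1 : ∀ x, f x ≤ 1) (c : ℝ) :
    0 ≤ ∫ x, f (x + c) ∂ρ ∧ ∫ x, f (x + c) ∂ρ ≤ 1 := by
  refine ⟨integral_nonneg fun x => h0 _, ?_⟩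
  simpa using integral_mono (integrable_shift (ρ := ρ) hf h0 h1 c) (integrable_const 1)
    fun x => h1 _

/-! ### Monotone iterates and the coupling comparison -/

section

variable {b : ℕ} {ρ : Measure ℝ} {G : ℝ → ℝ} {L : ℝ}

lemma iter_of_lt (n : ℕ) {θ : ℝ} (h : θ < 1) : iter b ρ G n θ = 0 := by
  cases n <;> simp [iter, h]

lemma iter_zero_of_le {θ : ℝ} (h : 1 ≤ θ) : iter b ρ G 0 θ = 1 := by simp [iter, h]

lemma iter_succ_of_le (n : ℕ) {θ : ℝ} (h : 1 ≤ θ) :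
    iter b ρ G (n + 1) θ = G (∫ x, iter b ρ G n (x + θ / b) ∂ρ) := by simp [iter, h]

variable [IsProbabilityMeasure ρ]

lemma iter_prop (hG : UnitLipschitz L G) (n : ℕ) :
    Monotone (iter b ρ G n) ∧ (∀ θ, 0 ≤ iter b ρ G n θ) ∧ ∀ θ, iter b ρ G n θ ≤ 1 := by
  induction n with
  | zero =>
    refine ⟨fun x y h => ?_, fun θ => ?_, fun θ => ?_⟩
    · simp only [iter]; split_ifs <;> linarith
    · simp only [iter]; split_ifs <;> norm_num
    · simp only [iter]; split_ifs <;> norm_num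
  | succ n ih =>
    obtain ⟨hm, h0, h1⟩ := ih
    have hI := integral_shift_mem (ρ := ρ) hm h0 h1
    have hb : ∀ θ, 0 ≤ iter b ρ G (n + 1) θ ∧ iter b ρ G (n + 1) θ ≤ 1 := by
      intro θ
      rcases lt_or_ge θ 1 with h | h
      · rw [iter_of_lt _ h]; norm_num
      · rw [iter_succ_of_le _ h]
        exact ⟨hG.zero_le.trans (hG.mono _ _ le_rfl (hI _).1 (hI _).2),
          (hG.mono _ _ (hI _).1 (hI _).2 le_rfl).trans hG.le_one⟩
    refine ⟨fun x y h => ?_, fun θ => (hb θ).1, fun θ => (hb θ).2⟩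
    rcases lt_or_ge x 1 with hx | hx
    · rw [iter_of_lt _ hx]; exact (hb y).1
    · rw [iter_succ_of_le _ hx, iter_succ_of_le _ (hx.trans h)]
      refine hG.mono _ _ (hI _).1 ?_ (hI _).2
      refine integral_mono (integrable_shift hm h0 h1 _) (integrable_shift hm h0 h1 _) fun z => ?_
      exact hm (by gcongr)

lemma iter_mono (hG : UnitLipschitz L G) (n : ℕ) : Monotone (iter b ρ G n) := (iter_prop hG n).1

lemma iter_nonneg (hG : UnitLipschitz L G) (n : ℕ) (θ : ℝ) : 0 ≤ iter b ρ G n θ :=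
  (iter_prop hG n).2.1 θ

lemma iter_le_one (hG : UnitLipschitz L G) (n : ℕ) (θ : ℝ) : iter b ρ G n θ ≤ 1 :=
  (iter_prop hG n).2.2 θ

lemma integrable_iter (hG : UnitLipschitz L G) (n : ℕ) (c : ℝ) :
    Integrable (fun x => iter b ρ G n (x + c)) ρ :=
  integrable_shift (iter_mono hG n) (iter_nonneg hG n) (iter_le_one hG n) c

lemma integral_iter_mem (hG : UnitLipschitz L G) (n : ℕ) (c : ℝ) :
    0 ≤ ∫ x, iter b ρ G n (x + c) ∂ρ ∧ ∫ x, iter b ρ G n (x + c) ∂ρ ≤ 1 :=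
  integral_shift_mem (iter_mono hG n) (iter_nonneg hG n) (iter_le_one hG n) c

lemma iter_succ_le (hG : UnitLipschitz L G) (n : ℕ) (θ : ℝ) :
    iter b ρ G (n + 1) θ ≤ iter b ρ G n θ := by
  induction n generalizing θ with
  | zero =>
    rcases lt_or_ge θ 1 with h | h
    · rw [iter_of_lt _ h, iter_of_lt _ h]
    · rw [iter_zero_of_le h]; exact iter_le_one hG _ _
  | succ n ih =>
    rcases lt_or_ge θ 1 with h | h
    · rw [iter_of_lt _ h, iter_of_lt _ h]
    · rw [iter_succ_of_le _ h, iter_succ_of_le _ h]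
      exact hG.mono _ _ (integral_iter_mem hG _ _).1
        (integral_mono (integrable_iter hG _ _) (integrable_iter hG _ _) fun x => ih _)
        (integral_iter_mem hG _ _).2

lemma iter_antitone (hG : UnitLipschitz L G) (θ : ℝ) : Antitone fun n => iter b ρ G n θ :=
  antitone_nat_of_succ_le fun n => iter_succ_le hG n θ

lemma unitLipschitz_id : UnitLipschitz 1 (id : ℝ → ℝ) :=
  ⟨le_rfl, le_rfl, fun _ _ _ h _ => h, fun _ _ _ _ _ => by simp⟩

/-- The comparison of the iterates at `θ` and at `θ + δ` through the first step at which the two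
coupled trajectories are separated by the threshold. -/
lemma iter_add_le (hL : 0 ≤ L) (hG : UnitLipschitz L G) {C : ℝ}
    (hC : ∀ a δ : ℝ, 0 ≤ δ → ρ.real (Set.Ico a (a + δ)) ≤ C * δ)
    (n : ℕ) {θ δ : ℝ} (hθ : 1 ≤ θ) (hδ : 0 ≤ δ) :
    iter b ρ G n (θ + δ) ≤ iter b ρ G n θ + ∑ k ∈ Finset.range n,
      L ^ (k + 1) * iter b ρ id k θ * (C * (δ / b ^ (k + 1))) *
        iter b ρ G (n - 1 - k) (1 + δ / b ^ (k + 1)) := by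
  induction n generalizing θ δ with
  | zero => simp [iter, hθ, le_add_of_le_of_nonneg hθ hδ]
  | succ n ih =>
    have hδb : 0 ≤ δ / b := by positivity
    set S : ℝ → ℝ := fun y => ∑ k ∈ Finset.range n,
      L ^ (k + 1) * iter b ρ id k y * (C * (δ / b / b ^ (k + 1))) *
        iter b ρ G (n - 1 - k) (1 + δ / b / b ^ (k + 1)) with hS
    -- The values of `X` for which the lower trajectory falls below `1` while the upper one, ahead
    -- by `δ / b`, stays at or above it. The upper value is then less than `1 + δ / b`.
    set A : Set ℝ := Set.Ico (1 - δ / b - θ / b) (1 - δ / b - θ / b + δ / b) with hA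
    have hpt : ∀ x, iter b ρ G n (x + (θ + δ) / b) ≤ iter b ρ G n (x + θ / b) + S (x + θ / b) +
        A.indicator (fun _ => iter b ρ G n (1 + δ / b)) x := by
      intro x
      have hx : x + (θ + δ) / b = x + θ / b + δ / b := by ring
      have hAn : 0 ≤ A.indicator (fun _ => iter b ρ G n (1 + δ / b)) x :=
        Set.indicator_nonneg (fun _ _ => iter_nonneg hG _ _) _
      rw [hx]
      rcases lt_or_ge (x + θ / b) 1 with h | h
      · have hS0 : S (x + θ / b) = 0 := by
          simp only [hS]
          refine Finset.sum_eq_zero fun k _ => ?_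
          rw [iter_of_lt k h]; ring
        rw [iter_of_lt n h, hS0]
        rcases lt_or_ge (x + θ / b + δ / b) 1 with h' | h'
        · rw [iter_of_lt n h']; linarith
        · rw [Set.indicator_of_mem]
          · have := iter_mono (b := b) (ρ := ρ) hG n
              (show x + θ / b + δ / b ≤ 1 + δ / b by linarith)
            linarith
          · constructor <;> linarith
      · have := ih h hδb
        linarith
    have hSint : Integrable (fun x => S (x + θ / b)) ρ := by
      refine integrable_finsetSum _ fun k _ => ?_
      exact (((integrable_iter unitLipschitz_id k _).const_mul _).mul_const _).mul_const _
    have hAint : Integrable (A.indicator fun _ => iter b ρ G n (1 + δ / b)) ρ :=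
      (integrable_const _).indicator measurableSet_Ico
    have hSval : ∫ x, S (x + θ / b) ∂ρ = ∑ k ∈ Finset.range n,
        L ^ (k + 1) * iter b ρ id (k + 1) θ * (C * (δ / b / b ^ (k + 1))) *
        iter b ρ G (n - 1 - k) (1 + δ / b / b ^ (k + 1)) := by
      simp only [hS]
      rw [integral_finsetSum _ fun k _ =>
        (((integrable_iter unitLipschitz_id k _).const_mul _).mul_const _).mul_const _]
      refine Finset.sum_congr rfl fun k _ => ?_
      rw [integral_mul_const, integral_mul_const, integral_const_mul, iter_succ_of_le k hθ, id]
    have hAval : ∫ x, A.indicator (fun _ => iter b ρ G n (1 + δ / b)) x ∂ρ ≤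
        C * (δ / b) * iter b ρ G n (1 + δ / b) := by
      rw [integral_indicator_const _ measurableSet_Ico, smul_eq_mul]
      exact mul_le_mul_of_nonneg_right (hC _ _ hδb) (iter_nonneg hG _ _)
    have hcmp : ∫ x, iter b ρ G n (x + (θ + δ) / b) ∂ρ ≤ ∫ x, iter b ρ G n (x + θ / b) ∂ρ +
        ∫ x, S (x + θ / b) ∂ρ + C * (δ / b) * iter b ρ G n (1 + δ / b) := by
      have hsumint : Integrable (fun x => iter b ρ G n (x + θ / b) + S (x + θ / b)) ρ :=
        (integrable_iter hG _ _).add hSint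
      refine (integral_mono (integrable_iter hG _ _) (hsumint.add hAint) hpt).trans ?_
      simp only [Pi.add_apply]
      rw [integral_add hsumint hAint,
        integral_add (integrable_iter hG _ _) hSint]
      linarith
    rw [iter_succ_of_le n hθ, iter_succ_of_le n (le_add_of_le_of_nonneg hθ hδ)]
    have hmono : ∫ x, iter b ρ G n (x + θ / b) ∂ρ ≤ ∫ x, iter b ρ G n (x + (θ + δ) / b) ∂ρ :=
      integral_mono (integrable_iter hG _ _) (integrable_iter hG _ _) fun x =>
        iter_mono hG n (by gcongr; linarith)
    have hlip := hG.lip _ _ (integral_iter_mem (b := b) (ρ := ρ) hG n (θ / b)).1 hmono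
      (integral_iter_mem hG n _).2
    have hmul := mul_le_mul_of_nonneg_left (sub_le_iff_le_add'.2 (hcmp.trans_eq (add_assoc _ _ _)))
      hL
    -- The term `k = 0` is separation at the present step; the others are the induction hypothesis
    -- shifted by one.
    rw [Finset.sum_range_succ']
    have hlast : L ^ (0 + 1) * iter b ρ id 0 θ * (C * (δ / b ^ (0 + 1))) *
        iter b ρ G (n + 1 - 1 - 0) (1 + δ / b ^ (0 + 1)) =
        L * (C * (δ / b) * iter b ρ G n (1 + δ / b)) := by
      rw [iter_zero_of_le hθ]; simp; ring
    have hsum : ∑ k ∈ Finset.range n, L ^ (k + 1 + 1) * iter b ρ id (k + 1) θ *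
        (C * (δ / b ^ (k + 1 + 1))) *
        iter b ρ G (n + 1 - 1 - (k + 1)) (1 + δ / b ^ (k + 1 + 1)) =
        L * ∫ x, S (x + θ / b) ∂ρ := by
      rw [hSval, Finset.mul_sum]
      refine Finset.sum_congr rfl fun k _ => ?_
      have e1 : δ / (b : ℝ) ^ (k + 1 + 1) = δ / b / b ^ (k + 1) := by
        rw [div_div, ← pow_succ']
      have e2 : n + 1 - 1 - (k + 1) = n - 1 - k := by omega
      rw [e1, e2, pow_succ' L (k + 1)]; ring
    rw [hlast, hsum]
    linarith

end

/-! ### The survival rate and its independence of the starting point -/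

section

variable {b : ℕ} {ρ : Measure ℝ} [IsProbabilityMeasure ρ]

/-- A trajectory that has survived `n` steps is at height at least `1`, so by monotonicity it does
at least as well as one restarted from `1`. -/
lemma iter_id_mul_le (n m : ℕ) (θ : ℝ) :
    iter b ρ id n θ * iter b ρ id m 1 ≤ iter b ρ id (n + m) θ := by
  induction n generalizing θ with
  | zero =>
    rcases lt_or_ge θ 1 with h | h
    · rw [iter_of_lt 0 h, zero_mul]; exact iter_nonneg unitLipschitz_id _ _
    · rw [iter_zero_of_le h, one_mul, zero_add]; exact iter_mono unitLipschitz_id m h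
  | succ n ih =>
    rcases lt_or_ge θ 1 with h | h
    · rw [iter_of_lt _ h, zero_mul]; exact iter_nonneg unitLipschitz_id _ _
    · rw [show n + 1 + m = n + m + 1 by ring, iter_succ_of_le _ h, iter_succ_of_le _ h, id, id,
        ← integral_mul_const]
      exact integral_mono ((integrable_iter unitLipschitz_id _ _).mul_const _)
        (integrable_iter unitLipschitz_id _ _) fun x => ih _

lemma iter_id_one_pos (hp : 0 < ρ.real (Set.Ici (1 - 1 / (b : ℝ)))) (n : ℕ) :
    0 < iter b ρ id n 1 := by
  have h1 : iter b ρ id 1 1 = ρ.real (Set.Ici (1 - 1 / (b : ℝ))) := by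
    rw [iter_succ_of_le 0 le_rfl, id, ← integral_indicator_one measurableSet_Ici]
    refine integral_congr_ae (ae_of_all _ fun x => ?_)
    simp [iter, Set.indicator_apply]
  induction n with
  | zero => simp [iter]
  | succ n ih => exact (mul_pos ih (h1 ▸ hp)).trans_le (iter_id_mul_le n 1 1)

/-- Fekete's lemma for `-log Z_n(1)`. Its limit is an infimum, which gives the bound `z ^ n` for
every `n` without a subexponential factor; the critical case depends on this. -/
lemma exists_rate (hp : 0 < ρ.real (Set.Ici (1 - 1 / (b : ℝ)))) :
    ∃ z : ℝ, 0 < z ∧ (∀ n, iter b ρ id n 1 ≤ z ^ n) ∧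
      Tendsto (fun n : ℕ => iter b ρ id n 1 ^ (1 / (n : ℝ))) atTop (𝓝 z) := by
  have hpos := iter_id_one_pos (b := b) hp
  have hsub : Subadditive fun n => -Real.log (iter b ρ id n 1) := by
    intro m n
    have := Real.log_le_log (mul_pos (hpos m) (hpos n)) (iter_id_mul_le m n 1)
    rw [Real.log_mul (hpos m).ne' (hpos n).ne'] at this
    dsimp only
    linarith
  have hbdd : BddBelow (Set.range fun n : ℕ => -Real.log (iter b ρ id n 1) / n) := by
    refine ⟨0, ?_⟩
    rintro _ ⟨n, rfl⟩
    have := Real.log_nonpos (hpos n).le (iter_le_one unitLipschitz_id n 1)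
    exact div_nonneg (by linarith) n.cast_nonneg
  refine ⟨Real.exp (-hsub.lim), Real.exp_pos _, fun n => ?_, ?_⟩
  · rcases eq_or_ne n 0 with rfl | hn
    · simp [iter]
    · have h := hsub.lim_le_div hbdd hn
      have hn' : (0 : ℝ) < n := by positivity
      rw [le_div_iff₀ hn'] at h
      rw [← Real.exp_nat_mul, ← Real.log_le_iff_le_exp (hpos n)]
      linarith
  · refine ((Real.continuous_exp.tendsto _).comp (hsub.tendsto_lim hbdd).neg).congr fun n => ?_
    simp only [Function.comp]
    rw [Real.rpow_def_of_pos (hpos n)]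
    congr 1
    ring

/-- A property of nonnegative reals valid near `0` and stable under multiplication by `b`. -/
lemma forall_nonneg_of_mul (hb : 1 < b) {P : ℝ → Prop} {ε : ℝ} (hε : 0 < ε)
    (h0 : ∀ δ, 0 ≤ δ → δ ≤ ε → P δ) (hmul : ∀ δ, 0 ≤ δ → P (δ / b) → P δ) (δ : ℝ) (hδ : 0 ≤ δ) :
    P δ := by
  have hb1 : (1 : ℝ) < b := by exact_mod_cast hb
  have key : ∀ m : ℕ, ∀ δ, 0 ≤ δ → δ ≤ b ^ m * ε → P δ := by
    intro m
    induction m with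
    | zero => intro δ h h'; exact h0 δ h (by simpa using h')
    | succ m ih =>
      intro δ h h'
      refine hmul δ h (ih _ (by positivity) ?_)
      rw [div_le_iff₀ (by linarith)]
      calc δ ≤ _ := h'
        _ = _ := by ring
  obtain ⟨m, hm⟩ := pow_unbounded_of_one_lt (δ / ε) hb1
  exact key m δ hδ ((div_le_iff₀ hε).1 hm.le)

lemma sum_inv_pow_le (hb : 1 < b) (n : ℕ) :
    ∑ k ∈ Finset.range n, (1 : ℝ) / b ^ (k + 1) ≤ 1 := by
  have hb2 : (2 : ℝ) ≤ b := by exact_mod_cast hb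
  have h : ∑ k ∈ Finset.range n, (1 : ℝ) / b ^ (k + 1) ≤ 1 - 1 / b ^ n := by
    induction n with
    | zero => simp
    | succ n ih =>
      rw [Finset.sum_range_succ]
      have h1 : (2 : ℝ) * (1 / b ^ (n + 1)) ≤ 1 / b ^ n := by
        rw [mul_one_div, div_le_div_iff₀ (by positivity) (by positivity), pow_succ]
        nlinarith [pow_pos (by linarith : (0 : ℝ) < b) n]
      linarith
  have : (0 : ℝ) ≤ 1 / b ^ n := by positivity
  linarith

lemma exists_bound_mul_pow (hb : 1 < b) {C : ℝ} (hC0 : 0 ≤ C)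
    (hC : ∀ a δ : ℝ, 0 ≤ δ → ρ.real (Set.Ico a (a + δ)) ≤ C * δ) {z : ℝ} (hz : 0 < z)
    (hle : ∀ n, iter b ρ id n 1 ≤ z ^ n) (δ : ℝ) (hδ : 0 ≤ δ) :
    ∃ K, 0 ≤ K ∧ ∀ n, iter b ρ id n (1 + δ) ≤ K * z ^ n := by
  have hb1 : (1 : ℝ) ≤ b := by exact_mod_cast hb.le
  -- In the coupling sum `z^k z^(n-1-k) = z^n / z`, and the remaining factors `1 / b^(k+1)` sum to
  -- at most `1`. Every gap after separation is at most `δ / b`.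
  have hbound : ∀ δ K : ℝ, 0 ≤ δ → 0 ≤ K → ∀ n : ℕ,
      (∀ j < n, iter b ρ id j (1 + δ / b) ≤ K * z ^ j) →
      iter b ρ id n (1 + δ) ≤ (1 + C * δ * K / z) * z ^ n := by
    intro δ K hδ hK n hn
    have h := iter_add_le (b := b) zero_le_one unitLipschitz_id hC n le_rfl hδ
    have hterm : ∀ k ∈ Finset.range n, (1 : ℝ) ^ (k + 1) * iter b ρ id k 1 *
        (C * (δ / b ^ (k + 1))) * iter b ρ id (n - 1 - k) (1 + δ / b ^ (k + 1)) ≤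
        C * δ * K / z * z ^ n * (1 / b ^ (k + 1)) := by
      intro k hk
      have hk' : k < n := Finset.mem_range.1 hk
      have h2 : iter b ρ id (n - 1 - k) (1 + δ / b ^ (k + 1)) ≤ K * z ^ (n - 1 - k) := by
        refine (iter_mono unitLipschitz_id _ ?_).trans (hn (n - 1 - k) (by omega))
        gcongr
        exact le_self_pow₀ hb1 (by omega)
      calc _ ≤ (1 : ℝ) ^ (k + 1) * z ^ k * (C * (δ / b ^ (k + 1))) * (K * z ^ (n - 1 - k)) := by
            gcongr
            · exact iter_nonneg unitLipschitz_id _ _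
            · exact hle k
        _ = C * δ * K / z * (z ^ k * z ^ (n - 1 - k) * z) * (1 / b ^ (k + 1)) := by
            field_simp; ring
        _ = _ := by
            rw [← pow_add, ← pow_succ]
            congr 3
            omega
    have hs := Finset.sum_le_sum hterm
    rw [← Finset.mul_sum] at hs
    have h3 : C * δ * K / z * z ^ n * ∑ k ∈ Finset.range n, (1 : ℝ) / b ^ (k + 1) ≤
        C * δ * K / z * z ^ n * 1 :=
      mul_le_mul_of_nonneg_left (sum_inv_pow_le hb n) (by positivity)
    have := hle n
    linarith
  -- For `δ ≤ ε` one has `2 C δ / z ≤ 1`, so the constant `K = 2` reproduces itself under `hbound`.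
  -- Larger gaps follow from the gap `δ / b`.
  refine forall_nonneg_of_mul hb
    (P := fun δ => ∃ K, 0 ≤ K ∧ ∀ n, iter b ρ id n (1 + δ) ≤ K * z ^ n)
    (ε := z / (2 * (C + 1))) (by positivity) ?_ ?_ δ hδ
  · intro δ hδ hδε
    refine ⟨2, by norm_num, fun n => ?_⟩
    have hq : C * δ * 2 / z ≤ 1 := by
      rw [le_div_iff₀ (by positivity)] at hδε
      rw [div_le_one hz]
      nlinarith
    induction n using Nat.strong_induction_on with
    | _ n ih =>
      refine (hbound δ 2 hδ (by norm_num) n fun j hj => ?_).trans ?_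
      · exact (iter_mono unitLipschitz_id _ (by gcongr; exact div_le_self hδ hb1)).trans (ih j hj)
      · gcongr; linarith
  · rintro δ hδ ⟨K, hK, h⟩
    exact ⟨_, by positivity, fun n => hbound δ K hδ hK n fun j _ => h j⟩

lemma tendsto_rate (hb : 1 < b) {C : ℝ} (hC0 : 0 ≤ C)
    (hC : ∀ a δ : ℝ, 0 ≤ δ → ρ.real (Set.Ico a (a + δ)) ≤ C * δ) {z : ℝ} (hz : 0 < z)
    (hle : ∀ n, iter b ρ id n 1 ≤ z ^ n)
    (hlim : Tendsto (fun n : ℕ => iter b ρ id n 1 ^ (1 / (n : ℝ))) atTop (𝓝 z))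
    {θ : ℝ} (hθ : 1 ≤ θ) :
    Tendsto (fun n : ℕ => iter b ρ id n θ ^ (1 / (n : ℝ))) atTop (𝓝 z) := by
  obtain ⟨K, hK, hKb⟩ := exists_bound_mul_pow hb hC0 hC hz hle (θ - 1) (by linarith)
  have hinv : Tendsto (fun n : ℕ => 1 / (n : ℝ)) atTop (𝓝 0) := tendsto_one_div_atTop_nhds_zero_nat
  -- `K` may vanish; `K + 1` has `n`-th roots tending to `1`.
  have hup : Tendsto (fun n : ℕ => (K + 1) ^ (1 / (n : ℝ)) * z) atTop (𝓝 z) := by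
    have := ((tendsto_const_nhds (x := K + 1)).rpow hinv
      (Or.inl (by positivity))).mul_const z
    simpa using this
  refine tendsto_of_tendsto_of_tendsto_of_le_of_le' hlim hup ?_ ?_
  · exact Eventually.of_forall fun n => Real.rpow_le_rpow (iter_nonneg unitLipschitz_id _ _)
      (iter_mono unitLipschitz_id _ hθ) (by positivity)
  · filter_upwards [eventually_ge_atTop 1] with n hn
    have h1 : iter b ρ id n θ ≤ (K + 1) * z ^ n := by
      have := hKb n
      rw [add_sub_cancel] at this
      nlinarith [pow_pos hz n]
    refine (Real.rpow_le_rpow (iter_nonneg unitLipschitz_id _ _) h1 (by positivity)).trans_eq ?_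
    rw [Real.mul_rpow (by positivity) (by positivity), one_div,
      Real.pow_rpow_inv_natCast hz.le (by omega)]

end

/-! ### The branching nonlinearity -/

/-- The probability that at least one of `b` independent events of probability `u` occurs. -/
def atLeastOne (b : ℕ) (u : ℝ) : ℝ := 1 - (1 - u) ^ b

lemma atLeastOne_succ (b : ℕ) (u : ℝ) :
    atLeastOne (b + 1) u = u + (1 - u) * atLeastOne b u := by
  simp only [atLeastOne]; ring

lemma atLeastOne_sub_le (b : ℕ) {p q : ℝ} (hp : 0 ≤ p) (hpq : p ≤ q) (hq : q ≤ 1) :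
    atLeastOne b q - atLeastOne b p ≤ b * (q - p) := by
  induction b with
  | zero => simp [atLeastOne]
  | succ b ih =>
    have h1 : (1 - p) ^ b ≤ 1 := pow_le_one₀ (by linarith) (by linarith)
    have h2 : 0 ≤ (1 - q) ^ b := pow_nonneg (by linarith) _
    have h3 : (1 - q) ^ b ≤ (1 - p) ^ b := pow_le_pow_left₀ (by linarith) (by linarith) _
    simp only [atLeastOne] at ih ⊢
    rw [pow_succ, pow_succ]
    push_cast
    nlinarith

lemma unitLipschitz_atLeastOne (b : ℕ) : UnitLipschitz b (atLeastOne b) where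
  zero_le := by simp [atLeastOne]
  le_one := by simp only [atLeastOne, sub_self]; linarith [pow_nonneg (le_refl (0 : ℝ)) b]
  mono p q _ hpq hq := by
    have := pow_le_pow_left₀ (show 0 ≤ 1 - q by linarith) (show 1 - q ≤ 1 - p by linarith) b
    simp only [atLeastOne]; linarith
  lip p q hp hpq hq := atLeastOne_sub_le b hp hpq hq

lemma atLeastOne_le (b : ℕ) {u : ℝ} (h0 : 0 ≤ u) (h1 : u ≤ 1) : atLeastOne b u ≤ b * u := by
  have := atLeastOne_sub_le b le_rfl h0 h1
  simpa [atLeastOne] using this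

lemma le_atLeastOne (b : ℕ) {u : ℝ} (h0 : 0 ≤ u) (h1 : u ≤ 1) :
    b * u * (1 - b * u) ≤ atLeastOne b u := by
  induction b with
  | zero => simp [atLeastOne]
  | succ b ih =>
    rw [atLeastOne_succ]
    have := mul_le_mul_of_nonneg_left ih (show 0 ≤ 1 - u by linarith)
    have h3 : 0 ≤ (b : ℝ) ^ 2 * u ^ 3 := by positivity
    have h4 : 0 ≤ (b : ℝ) * u ^ 2 := by positivity
    push_cast
    nlinarith [sq_nonneg u]

/-- For `b ≥ 2` the union bound overcounts by a term quadratic in `u`; when `u ≥ c` this is a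
definite fraction of `b * u`. -/
lemma atLeastOne_le_mul {b : ℕ} (hb : 1 < b) {u c : ℝ} (h1 : u ≤ 1) (hc : 0 ≤ c)
    (hcu : c ≤ u) : atLeastOne b u ≤ (1 - c / 2) * (b * u) := by
  obtain ⟨b, rfl⟩ : ∃ a, b = a + 1 := ⟨b - 1, by omega⟩
  have hb1 : (1 : ℝ) ≤ b := by exact_mod_cast (by omega : 1 ≤ b)
  have h0 : 0 ≤ u := hc.trans hcu
  rw [atLeastOne_succ]
  have h := mul_le_mul_of_nonneg_left (atLeastOne_le b h0 h1) (show 0 ≤ 1 - u by linarith)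
  have h2 : 0 ≤ u * (b * (u - c / 2) - c / 2) := by
    refine mul_nonneg h0 ?_
    nlinarith
  push_cast
  nlinarith

/-! ### Extinction up to criticality and survival above it -/

section

variable {b : ℕ} {ρ : Measure ℝ} [IsProbabilityMeasure ρ]

lemma tendsto_iter_one_zero (hb : 1 < b) (hle : ∀ n, iter b ρ id n 1 ≤ (1 / (b : ℝ)) ^ n) :
    Tendsto (fun n => iter b ρ (atLeastOne b) n 1) atTop (𝓝 0) := by
  have hb0 : (0 : ℝ) < b := by exact_mod_cast (by omega : 0 < b)
  have hG := unitLipschitz_atLeastOne b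
  have hbdd : BddBelow (Set.range fun n => iter b ρ (atLeastOne b) n 1) :=
    ⟨0, by rintro _ ⟨n, rfl⟩; exact iter_nonneg hG n 1⟩
  have hlim := tendsto_atTop_ciInf (iter_antitone (b := b) (ρ := ρ) hG 1) hbdd
  set c := ⨅ n, iter b ρ (atLeastOne b) n 1 with hc
  have hcle : ∀ n, c ≤ iter b ρ (atLeastOne b) n 1 := fun n => ciInf_le hbdd n
  have hc0 : 0 ≤ c := le_ciInf fun n => iter_nonneg hG n 1
  have hc1 : c ≤ 1 := (hcle 0).trans (iter_le_one hG _ _)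
  rcases hc0.eq_or_lt with h | hcpos
  · rwa [← h] at hlim
  exfalso
  set q := 1 - c / b / 2 with hq
  have hq0 : 0 ≤ q := by
    have : c / b ≤ 1 := (div_le_one hb0).2 (hc1.trans (by exact_mod_cast hb.le))
    linarith
  have hq1 : q < 1 := by
    have : 0 < c / b := by positivity
    linarith
  have hbound : ∀ n θ, iter b ρ (atLeastOne b) n θ ≤ (q * b) ^ n * iter b ρ id n θ := by
    intro n
    induction n with
    | zero => intro θ; simp [iter]
    | succ n ih =>
      intro θ
      rcases lt_or_ge θ 1 with h | h
      · rw [iter_of_lt _ h, iter_of_lt _ h, mul_zero]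
      · rw [iter_succ_of_le _ h, iter_succ_of_le _ h, id]
        obtain ⟨hI0, hI1⟩ := integral_iter_mem (b := b) (ρ := ρ) hG n (θ / b)
        -- The limit `c` bounds generation `n + 1` from any `θ ≥ 1`, and the union bound turns this
        -- into a bound on the one-daughter probability.
        have hlow : c / b ≤ ∫ x, iter b ρ (atLeastOne b) n (x + θ / b) ∂ρ := by
          rw [div_le_iff₀' hb0]
          refine le_trans ?_ (atLeastOne_le b hI0 hI1)
          rw [← iter_succ_of_le (b := b) (ρ := ρ) (G := atLeastOne b) n h]
          exact (hcle _).trans (iter_mono hG _ h)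
        refine (atLeastOne_le_mul hb hI1 (by positivity) hlow).trans ?_
        rw [pow_succ, ← mul_assoc, mul_comm _ (q * b), mul_assoc (q * (b : ℝ))]
        refine mul_le_mul_of_nonneg_left ?_ (by positivity)
        rw [← integral_const_mul]
        exact integral_mono (integrable_iter hG _ _)
          ((integrable_iter unitLipschitz_id _ _).const_mul _) fun x => ih _
  have hle' : ∀ n, c ≤ q ^ n := by
    intro n
    calc c ≤ _ := hcle n
      _ ≤ _ := hbound n 1
      _ ≤ (q * b) ^ n * (1 / (b : ℝ)) ^ n := by gcongr; exact hle n
      _ = q ^ n := by rw [← mul_pow, mul_assoc, mul_one_div_cancel hb0.ne', mul_one]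
  have := ge_of_tendsto' (tendsto_pow_atTop_nhds_zero_of_lt_one hq0 hq1) hle'
  linarith

lemma tendsto_iter_zero (hb : 1 < b) {C : ℝ} (hC0 : 0 ≤ C)
    (hC : ∀ a δ : ℝ, 0 ≤ δ → ρ.real (Set.Ico a (a + δ)) ≤ C * δ)
    (hle : ∀ n, iter b ρ id n 1 ≤ (1 / (b : ℝ)) ^ n) (δ : ℝ) (hδ : 0 ≤ δ) :
    Tendsto (fun n => iter b ρ (atLeastOne b) n (1 + δ)) atTop (𝓝 0) := by
  have hb1 : (1 : ℝ) < b := by exact_mod_cast hb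
  have hb0 : (0 : ℝ) < b := by linarith
  have hG := unitLipschitz_atLeastOne b
  have hone := tendsto_iter_one_zero (b := b) (ρ := ρ) hb hle
  -- The coupling sum over `2 * m` terms is split in the middle: for `k < m` at least `m`
  -- generations remain, so the factor is at most that of generation `m`; for `k ≥ m` the weights
  -- are small. Here `b^(k+1)` from the Lipschitz constant is cancelled by `Z_k(1) ≤ b^(-k)`, up to
  -- one factor `b`.
  have hbound : ∀ δ, 0 ≤ δ → ∀ m : ℕ, iter b ρ (atLeastOne b) (2 * m) (1 + δ) ≤
      iter b ρ (atLeastOne b) (2 * m) 1 +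
        b * C * δ * (iter b ρ (atLeastOne b) m (1 + δ / b) + (1 / (b : ℝ)) ^ m) := by
    intro δ hδ m
    have h := iter_add_le (b := b) hb0.le hG hC (2 * m) le_rfl hδ
    set y := iter b ρ (atLeastOne b) m (1 + δ / b) with hy
    have hy0 : 0 ≤ y := iter_nonneg hG _ _
    have hterm : ∀ k, (b : ℝ) ^ (k + 1) * iter b ρ id k 1 * (C * (δ / b ^ (k + 1))) *
        iter b ρ (atLeastOne b) (2 * m - 1 - k) (1 + δ / b ^ (k + 1)) ≤
        b * C * δ * iter b ρ (atLeastOne b) (2 * m - 1 - k) (1 + δ / b) * (1 / b ^ (k + 1)) := by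
      intro k
      calc _ ≤ (b : ℝ) ^ (k + 1) * (1 / (b : ℝ)) ^ k * (C * (δ / b ^ (k + 1))) *
            iter b ρ (atLeastOne b) (2 * m - 1 - k) (1 + δ / b) := by
            gcongr
            · exact iter_nonneg hG _ _
            · exact hle k
            · exact iter_mono hG _ (by gcongr; exact le_self_pow₀ hb1.le (by omega))
        _ = _ := by rw [one_div, inv_pow, pow_succ]; field_simp
    have hhead : ∀ k ∈ Finset.range m, (b : ℝ) ^ (k + 1) * iter b ρ id k 1 *
        (C * (δ / b ^ (k + 1))) * iter b ρ (atLeastOne b) (2 * m - 1 - k) (1 + δ / b ^ (k + 1)) ≤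
        b * C * δ * y * (1 / b ^ (k + 1)) := by
      intro k hk
      have hk' := Finset.mem_range.1 hk
      refine (hterm k).trans ?_
      gcongr
      exact iter_antitone hG _ (by omega)
    have htail : ∀ k ∈ Finset.range m, (b : ℝ) ^ (m + k + 1) * iter b ρ id (m + k) 1 *
        (C * (δ / b ^ (m + k + 1))) *
          iter b ρ (atLeastOne b) (2 * m - 1 - (m + k)) (1 + δ / b ^ (m + k + 1)) ≤
        b * C * δ * (1 / (b : ℝ)) ^ m * (1 / b ^ (k + 1)) := by
      intro k _
      refine (hterm (m + k)).trans ?_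
      calc _ ≤ b * C * δ * 1 * (1 / (b : ℝ) ^ (m + k + 1)) := by
            gcongr; exact iter_le_one hG _ _
        _ = _ := by rw [add_assoc, pow_add, one_div_pow]; field_simp
    rw [two_mul m, Finset.sum_range_add, ← two_mul] at h
    have hs1 := Finset.sum_le_sum hhead
    have hs2 := Finset.sum_le_sum htail
    rw [← Finset.mul_sum] at hs1 hs2
    have h3 := mul_le_mul_of_nonneg_left (sum_inv_pow_le hb m)
      (show 0 ≤ b * C * δ * y by positivity)
    have h4 := mul_le_mul_of_nonneg_left (sum_inv_pow_le hb m)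
      (show 0 ≤ b * C * δ * (1 / (b : ℝ)) ^ m by positivity)
    linarith
  set l : ℝ → ℝ := fun δ => ⨅ n, iter b ρ (atLeastOne b) n (1 + δ) with hl
  have hbdd : ∀ δ, BddBelow (Set.range fun n => iter b ρ (atLeastOne b) n (1 + δ)) := fun δ =>
    ⟨0, by rintro _ ⟨n, rfl⟩; exact iter_nonneg hG n _⟩
  have hlim : ∀ δ, Tendsto (fun n => iter b ρ (atLeastOne b) n (1 + δ)) atTop (𝓝 (l δ)) :=
    fun δ => tendsto_atTop_ciInf (iter_antitone (b := b) (ρ := ρ) hG _) (hbdd δ)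
  have hl0 : ∀ δ, 0 ≤ l δ := fun δ => le_ciInf fun n => iter_nonneg hG n _
  have hlmono : Monotone l := fun x y h =>
    ciInf_mono (hbdd x) fun n => iter_mono hG n (by linarith)
  have hlle : ∀ δ, 0 ≤ δ → l δ ≤ b * C * δ * l (δ / b) := by
    intro δ hδ
    have h2 : Tendsto (fun m : ℕ => 2 * m) atTop atTop := tendsto_id.const_mul_atTop' two_pos
    have hr : Tendsto (fun m : ℕ => (1 / (b : ℝ)) ^ m) atTop (𝓝 0) :=
      tendsto_pow_atTop_nhds_zero_of_lt_one (by positivity) ((div_lt_one hb0).2 hb1)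
    have := le_of_tendsto_of_tendsto' ((hlim δ).comp h2)
      ((hone.comp h2).add (((hlim (δ / b)).add hr).const_mul (b * C * δ))) (hbound δ hδ)
    simpa using this
  suffices l δ = 0 by rw [← this]; exact hlim δ
  -- For `δ ≤ ε` the factor `b C δ` is at most `1/2`, so `l δ ≤ l (δ / b) / 2 ≤ l δ / 2` and `l δ`
  -- vanishes.
  refine forall_nonneg_of_mul hb (P := fun δ => l δ = 0) (ε := 1 / (2 * (b * C + 1)))
    (by positivity) ?_ ?_ δ hδ
  · intro δ hδ hδε
    have hq : b * C * δ ≤ 1 / 2 := by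
      rw [le_div_iff₀ (by positivity)] at hδε
      nlinarith
    have h1 := hlle δ hδ
    have h2 := hlmono (div_le_self hδ hb1.le)
    have h3 := mul_le_mul hq h2 (hl0 _) (by norm_num)
    linarith [hl0 δ]
  · intro δ hδ h
    have := hlle δ hδ
    rw [h, mul_zero] at this
    exact le_antisymm this (hl0 δ)

lemma exists_iter_lower_bound (hb : 1 < b) {N : ℕ} (hN : (1 / (b : ℝ)) ^ N < iter b ρ id N 1) :
    ∃ ε, 0 < ε ∧ ∀ n, ε ≤ iter b ρ (atLeastOne b) n 1 := by
  have hb1 : (1 : ℝ) < b := by exact_mod_cast hb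
  have hb0 : (0 : ℝ) < b := by linarith
  have hG := unitLipschitz_atLeastOne b
  have hid := unitLipschitz_id
  have hN0 : N ≠ 0 := by
    rintro rfl
    simp [iter] at hN
  set a := (b : ℝ) ^ N * iter b ρ id N 1 - 1 with ha
  have ha0 : 0 < a := by
    rw [one_div, inv_pow, inv_lt_iff_one_lt_mul₀' (by positivity)] at hN
    linarith
  set h : ℝ → ℝ := fun θ => ∑ k ∈ Finset.range N, (b : ℝ) ^ k * iter b ρ id k θ with hh
  set H : ℝ := ∑ k ∈ Finset.range N, (b : ℝ) ^ k with hH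
  have hH0 : 0 < H := Finset.sum_pos (fun k _ => by positivity) (by simpa using hN0)
  have hh0 : ∀ θ, 0 ≤ h θ := fun θ =>
    Finset.sum_nonneg fun k _ => mul_nonneg (by positivity) (iter_nonneg hid _ _)
  have hhH : ∀ θ, h θ ≤ H := fun θ => Finset.sum_le_sum fun k _ =>
    mul_le_of_le_one_right (by positivity) (iter_le_one hid _ _)
  have hhlt : ∀ θ, θ < 1 → h θ = 0 := fun θ hθ =>
    Finset.sum_eq_zero fun k _ => by rw [iter_of_lt k hθ, mul_zero]
  have hh1 : 1 ≤ h 1 := by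
    have := Finset.single_le_sum (f := fun k => (b : ℝ) ^ k * iter b ρ id k 1)
      (fun k _ => mul_nonneg (by positivity) (iter_nonneg hid _ _))
      (Finset.mem_range.2 (Nat.pos_of_ne_zero hN0))
    simpa [iter] using this
  have hhint : ∀ c, Integrable (fun x => h (x + c)) ρ := fun c =>
    integrable_finsetSum _ fun k _ => (integrable_iter hid k c).const_mul _
  -- Telescoping: applying `bT` to `h` removes the term `Z_0 = 1` and adds `b^N Z_N(θ) ≥ b^N Z_N(1)
  -- = 1 + a`.
  have hstep : ∀ θ, 1 ≤ θ → h θ + a ≤ b * ∫ x, h (x + θ / b) ∂ρ := by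
    intro θ hθ
    have e1 : b * ∫ x, h (x + θ / b) ∂ρ =
        ∑ k ∈ Finset.range N, (b : ℝ) ^ (k + 1) * iter b ρ id (k + 1) θ := by
      simp only [hh]
      rw [integral_finsetSum _ fun k _ => (integrable_iter hid k _).const_mul _, Finset.mul_sum]
      refine Finset.sum_congr rfl fun k _ => ?_
      rw [integral_const_mul, iter_succ_of_le k hθ, id, pow_succ']; ring
    have e2 := Finset.sum_range_succ (fun k => (b : ℝ) ^ k * iter b ρ id k θ) N
    rw [Finset.sum_range_succ', iter_zero_of_le hθ] at e2
    have h3 : (b : ℝ) ^ N * iter b ρ id N 1 ≤ b ^ N * iter b ρ id N θ := by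
      gcongr; exact iter_mono hid N hθ
    rw [e1]
    simp only [hh]
    simp only [pow_zero, mul_one] at e2
    linarith
  -- The first bound starts the induction; the second keeps the quadratic loss below the gain from
  -- `a`.
  set ε := min (1 / H) (a / (b * H * (H + a))) with hε
  have hε0 : 0 < ε := lt_min (by positivity) (by positivity)
  have hεH : ε * H ≤ 1 := (le_div_iff₀ hH0).1 (min_le_left _ _)
  have hεa : ε * (b * H * (H + a)) ≤ a := (le_div_iff₀ (by positivity)).1 (min_le_right _ _)
  have key : ∀ n θ, ε * h θ ≤ iter b ρ (atLeastOne b) n θ := by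
    intro n
    induction n with
    | zero =>
      intro θ
      rcases lt_or_ge θ 1 with hθ | hθ
      · rw [hhlt θ hθ, mul_zero, iter_of_lt _ hθ]
      · rw [iter_zero_of_le hθ]
        exact (mul_le_mul_of_nonneg_left (hhH θ) hε0.le).trans hεH
    | succ n ih =>
      intro θ
      rcases lt_or_ge θ 1 with hθ | hθ
      · rw [hhlt θ hθ, mul_zero, iter_of_lt _ hθ]
      · rw [iter_succ_of_le _ hθ]
        obtain ⟨hI0, hI1⟩ := integral_iter_mem (b := b) (ρ := ρ) hG n (θ / b)
        set I := ∫ x, h (x + θ / b) ∂ρ with hI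
        have hIle : ε * I ≤ ∫ x, iter b ρ (atLeastOne b) n (x + θ / b) ∂ρ := by
          rw [hI, ← integral_const_mul]
          exact integral_mono ((hhint _).const_mul _) (integrable_iter hG _ _) fun x => ih _
        have hInn : 0 ≤ I := integral_nonneg fun x => hh0 _
        have hIH : I ≤ H := by
          simpa using integral_mono (hhint (θ / b)) (integrable_const H) fun x => hhH _
        have hu0 : 0 ≤ ε * I := by positivity
        refine le_trans ?_ (hG.mono _ _ hu0 hIle hI1)
        refine le_trans ?_ (le_atLeastOne b hu0 (hIle.trans hI1))
        have hs := hstep θ hθ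
        -- Since `h ≤ H`, the additive gain `a` is a multiplicative gain of `1 + a / H`.
        have h1 : h θ * (H + a) ≤ b * I * H := by nlinarith [hhH θ, hh0 θ]
        have h2 : H ≤ (1 - b * (ε * I)) * (H + a) := by
          have : b * (ε * I) * (H + a) ≤ a :=
            le_trans (by nlinarith [mul_nonneg (mul_nonneg hb0.le hε0.le) (add_pos hH0 ha0).le])
              hεa
          linarith
        have h3 : b * I * H ≤ b * I * ((1 - b * (ε * I)) * (H + a)) :=
          mul_le_mul_of_nonneg_left h2 (by positivity)
        have h4 : h θ ≤ b * I * (1 - b * (ε * I)) := by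
          refine le_of_mul_le_mul_right ?_ (add_pos hH0 ha0)
          linarith
        calc ε * h θ ≤ ε * (b * I * (1 - b * (ε * I))) := by gcongr
          _ = _ := by ring
  refine ⟨ε, hε0, fun n => le_trans ?_ (key n 1)⟩
  nlinarith

end

/-! ### From the dynamics to active paths -/

/-- The value of the site `σ` when the root receives `κ` and all the sites above `σ` topple. -/
def val {b : ℕ} : Site b → ℝ → (Site b → ℝ) → ℝ
  | [], κ, X => X [] + κ
  | i :: σ, κ, X => val σ ((X [] + κ) / b) fun τ => X (i :: τ)

/-- All the sites on the path from the root to `σ`, including both, reach the threshold. -/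
def Active {b : ℕ} : Site b → ℝ → (Site b → ℝ) → Prop
  | [], κ, X => 1 ≤ X [] + κ
  | i :: σ, κ, X => 1 ≤ X [] + κ ∧ Active σ ((X [] + κ) / b) fun τ => X (i :: τ)

section

variable {b : ℕ}

lemma val_append_singleton (σ : Site b) (j : Fin b) (κ : ℝ) (X : Site b → ℝ) :
    val (σ ++ [j]) κ X = X (σ ++ [j]) + val σ κ X / b := by
  induction σ generalizing κ X with
  | nil => simp [val]
  | cons i σ ih => simpa [val] using ih _ _

lemma active_append_singleton (σ : Site b) (j : Fin b) (κ : ℝ) (X : Site b → ℝ) :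
    Active (σ ++ [j]) κ X ↔ Active σ κ X ∧ 1 ≤ val (σ ++ [j]) κ X := by
  induction σ generalizing κ X with
  | nil => simp [val, Active]
  | cons i σ ih => simp [val, Active, ih, and_assoc]

lemma Active.of_append {σ τ : Site b} {κ : ℝ} {X : Site b → ℝ} (h : Active (σ ++ τ) κ X) :
    Active σ κ X := by
  induction σ generalizing κ X with
  | nil => cases τ with
    | nil => exact h
    | cons i τ => exact h.1
  | cons i σ ih => exact ⟨h.1, ih h.2⟩

/-- The value of `σ` once its mother had the occasion to topple. -/
def load (X : Site b → ℝ) (v : ℝ) (σ : Site b) : ℝ :=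
  open scoped Classical in if σ = [] ∨ Active σ.dropLast v X then val σ v X else X σ

lemma load_of_active {X : Site b → ℝ} {v : ℝ} {σ : Site b} (h : Active σ v X) :
    load X v σ = val σ v X := by
  rcases List.eq_nil_or_concat' σ with rfl | ⟨τ, j, rfl⟩
  · simp [load]
  · rw [active_append_singleton] at h
    simp [load, h.1]

lemma active_iff_one_le_load {X : Site b → ℝ} (hX : ∀ σ, X σ < 1) {v : ℝ} {σ : Site b} :
    Active σ v X ↔ 1 ≤ load X v σ := by
  rcases List.eq_nil_or_concat' σ with rfl | ⟨τ, j, rfl⟩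
  · simp [load, val, Active]
  · rw [active_append_singleton]
    by_cases h : Active τ v X <;> simp [load, h, hX]

/-- With all initial values below `1`, a mother is at or above the threshold only at the time equal
to her depth. So a site is untouched before its own depth, receives at most once, and is settled one
step after that depth. The induction on time treats all sites together. -/
lemma process_eq {X : Site b → ℝ} (hX : ∀ σ, X σ < 1) {v : ℝ} (t : ℕ) (σ : Site b) :
    (t < σ.length → process b X v t σ = X σ) ∧
    (σ.length ≤ t → (t = σ.length ∨ ¬ Active σ v X) → process b X v t σ = load X v σ) ∧
    (σ.length < t → Active σ v X → process b X v t σ = 0) := by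
  induction t generalizing σ with
  | zero =>
    rcases List.eq_nil_or_concat' σ with rfl | ⟨τ, j, rfl⟩
    · simp [process, load, val]
    · simp [process]
  | succ t ih =>
    have hact := active_iff_one_le_load hX (v := v) (σ := σ)
    -- the evolution of a site that receives nothing
    have hquiet : (¬ (σ ≠ [] ∧ 1 ≤ process b X v t σ.dropLast)) → process b X v (t + 1) σ =
        if 1 ≤ process b X v t σ then 0 else process b X v t σ := by
      intro h; rw [process, if_neg h]
    have hlate : (¬ (σ ≠ [] ∧ 1 ≤ process b X v t σ.dropLast)) → σ.length ≤ t →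
        (¬ Active σ v X → process b X v (t + 1) σ = load X v σ) ∧
        (Active σ v X → process b X v (t + 1) σ = 0) := by
      intro h ht
      rw [hquiet h]
      constructor
      · intro hna
        rw [(ih σ).2.1 ht (Or.inr hna), if_neg (fun h' => hna (hact.2 h'))]
      · intro ha
        rcases ht.eq_or_lt with h' | h'
        · rw [(ih σ).2.1 ht (Or.inl h'.symm), if_pos (hact.1 ha)]
        · rw [(ih σ).2.2 h' ha]; norm_num
    rcases List.eq_nil_or_concat' σ with rfl | ⟨τ, j, rfl⟩
    · have := hlate (by simp) (by simp)
      refine ⟨by simp, fun _ h => this.1 (by simpa using h), fun _ h => this.2 h⟩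
    · have hd : (τ ++ [j]).dropLast = τ := by simp
      have hlen : (τ ++ [j]).length = τ.length + 1 := by simp
      have hactτ := active_iff_one_le_load hX (v := v) (σ := τ)
      have hmother : 1 ≤ process b X v t τ ↔ t = τ.length ∧ Active τ v X := by
        rcases lt_trichotomy t τ.length with h | h | h
        · rw [(ih τ).1 h]
          exact ⟨fun h' => absurd (hX τ) (not_lt.2 h'), fun h' => absurd h'.1 h.ne⟩
        · rw [(ih τ).2.1 h.ge (Or.inl h), ← hactτ]; tauto
        · by_cases ha : Active τ v X
          · rw [(ih τ).2.2 h ha]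
            exact ⟨fun h' => absurd h' (by norm_num), fun h' => absurd h'.1 h.ne'⟩
          · rw [(ih τ).2.1 h.le (Or.inr ha), ← hactτ]; tauto
      by_cases hm : t = τ.length ∧ Active τ v X
      · have hp : process b X v (t + 1) (τ ++ [j]) = load X v (τ ++ [j]) := by
          rw [process, if_pos ⟨by simp, by rw [hd]; exact hmother.2 hm⟩, hd,
            (ih _).1 (by omega), (ih τ).2.1 hm.1.ge (Or.inl hm.1), load_of_active hm.2, load, hd,
            if_pos (Or.inr hm.2), val_append_singleton, one_div_mul_eq_div]
        exact ⟨fun h => by omega, fun _ _ => hp, fun h => by omega⟩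
      · have hn : ¬ (τ ++ [j] ≠ [] ∧ 1 ≤ process b X v t (τ ++ [j]).dropLast) := by
          rw [hd, hmother]; tauto
        have hearly : t < (τ ++ [j]).length → process b X v (t + 1) (τ ++ [j]) = X (τ ++ [j]) := by
          intro h
          rw [hquiet hn, (ih _).1 h, if_neg (not_le.2 (hX _))]
        refine ⟨fun h => hearly (by omega), fun h h' => ?_, fun h => (hlate hn (by omega)).2⟩
        rcases h.eq_or_lt with he | hl
        · have hna : ¬ Active τ v X := fun h'' => hm ⟨by omega, h''⟩
          rw [hearly (by omega), load, hd, if_neg (by simp [hna])]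
        · exact (hlate hn (by omega)).1 (h'.resolve_left hl.ne')

lemma avalanche_eq {X : Site b → ℝ} (h0 : ∀ σ, 0 ≤ X σ) (hX : ∀ σ, X σ < 1) {v : ℝ} :
    avalanche b X v = {σ | Active σ v X} := by
  ext σ
  simp only [avalanche, avalancheBy, Set.mem_iUnion, Set.mem_ofPred_eq]
  have hp := fun t => process_eq hX (v := v) t σ
  constructor
  · rintro ⟨t, ht, s, hst, hs⟩
    by_contra hna
    rcases lt_or_ge t σ.length with h | h
    · rw [(hp t).1 h] at ht
      rw [(hp s).1 (hst.trans h)] at hs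
      exact hs ht
    · rw [(hp t).2.1 h (Or.inr hna)] at ht
      rcases lt_or_ge s σ.length with h' | h'
      · rw [(hp s).1 h'] at hs
        rcases List.eq_nil_or_concat' σ with rfl | ⟨τ, j, rfl⟩
        · simp at h'
        · have hpos := (h0 (τ ++ [j])).lt_of_ne' hs
          by_cases ha : Active τ v X
          · have h1 := (active_iff_one_le_load hX).1 ha
            rw [load_of_active ha] at h1
            rw [load, if_pos (Or.inr (by simpa using ha)), val_append_singleton] at ht
            have : 0 ≤ val τ v X / b := by positivity
            linarith
          · rw [load, if_neg (by simp [ha])] at ht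
            exact hs ht
      · rw [(hp s).2.1 h' (Or.inr hna)] at hs
        exact hs ht
  · intro ha
    refine ⟨σ.length + 1, (hp _).2.2 (Nat.lt_succ_self _) ha, σ.length, Nat.lt_succ_self _, ?_⟩
    rw [(hp _).2.1 le_rfl (Or.inl rfl)]
    have := (active_iff_one_le_load hX).1 ha
    linarith

/-- The configurations for which some site of generation `n` is active. -/
def reaches (b : ℕ) (n : ℕ) (κ : ℝ) : Set (Site b → ℝ) :=
  {X | ∃ σ : Site b, σ.length = n ∧ Active σ κ X}

lemma reaches_antitone (κ : ℝ) : Antitone fun n => reaches b n κ := by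
  rintro m n hmn X ⟨σ, hσ, ha⟩
  refine ⟨σ.take m, by simp [hσ, hmn], ?_⟩
  rw [← List.take_append_drop m σ] at ha
  exact ha.of_append

/-- The tree is locally finite: infinitely many active sites must have unbounded depth. -/
lemma setOf_active_infinite_iff (κ : ℝ) (X : Site b → ℝ) :
    {σ : Site b | Active σ κ X}.Infinite ↔ X ∈ ⋂ n, reaches b n κ := by
  rw [Set.mem_iInter]
  constructor
  · intro h n
    by_contra hn
    refine h ((List.finite_length_lt (Fin b) n).subset fun σ hσ => ?_)
    by_contra hlen
    exact hn (reaches_antitone κ (not_lt.1 hlen) ⟨σ, rfl, hσ⟩)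
  · intro h hfin
    obtain ⟨N, hN⟩ := (hfin.image List.length).bddAbove
    obtain ⟨σ, hσ, ha⟩ := h (N + 1)
    have := hN ⟨σ, ha, hσ⟩
    omega

end

/-! ### Recursive decomposition of the product laws -/

/-- The configuration with value `p.1` at `none` and `p.2` elsewhere, relabelled along `e`. -/
def consAlong {κ ι : Type*} (e : Option κ ≃ ι) (p : ℝ × (κ → ℝ)) (i : ι) : ℝ :=
  (e.symm i).elim p.1 p.2

lemma measurable_consAlong {κ ι : Type*} (e : Option κ ≃ ι) : Measurable (consAlong e) := by
  refine measurable_pi_lambda _ fun i => ?_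
  simp only [consAlong]
  rcases e.symm i with _ | k <;> simp only [Option.elim] <;> fun_prop

/-- It suffices to compare finite-dimensional boxes. The relabelling serves both to split off the
first entry of a sequence and to split off the root of the tree. -/
lemma map_consAlong {κ ι : Type*} (e : Option κ ≃ ι) (ρ : Measure ℝ) [IsProbabilityMeasure ρ] :
    (ρ.prod (Measure.infinitePi fun _ : κ => ρ)).map (consAlong e) =
      Measure.infinitePi fun _ : ι => ρ := by
  classical
  refine Measure.eq_infinitePi _ fun s t ht => ?_
  rw [Measure.map_apply (measurable_consAlong e) (.pi s.countable_toSet fun i _ => ht i)]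
  let f : κ ↪ ι := Function.Embedding.some.trans e.toEmbedding
  have hf : ∀ k, f k = e (some k) := fun _ => rfl
  set P : Finset κ := s.preimage f f.injective.injOn with hP
  have hmem : ∀ k, k ∈ P ↔ e (some k) ∈ s := fun k => Finset.mem_preimage
  have hpre : consAlong e ⁻¹' (s : Set ι).pi t =
      (if e none ∈ s then t (e none) else Set.univ) ×ˢ (P : Set κ).pi fun k => t (f k) := by
    ext ⟨x, y⟩
    simp only [Set.mem_preimage, Set.mem_pi, Set.mem_prod, consAlong, Finset.mem_coe, hmem, hf]
    rw [← e.forall_congr_right, Option.forall]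
    simp only [Equiv.symm_apply_apply, Option.elim]
    refine and_congr ?_ Iff.rfl
    split_ifs with h <;> simp [h]
  rw [hpre, Measure.prod_prod, Measure.infinitePi_pi _ fun k _ => ht _]
  have hsum : s = (if e none ∈ s then {e none} else ∅) ∪ P.map f := by
    ext i
    obtain ⟨o, rfl⟩ := e.surjective i
    rcases o with _ | k <;> split_ifs with h <;> simp [h, hmem, hf]
  conv_rhs => rw [hsum]
  rw [Finset.prod_union, Finset.prod_map]
  · congr 1
    split_ifs <;> simp
  · split_ifs <;> simp [hf]

lemma measureReal_prod_eq_integral {α β : Type*} [MeasurableSpace α] [MeasurableSpace β]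
    (μ : Measure α) (ν : Measure β) [IsProbabilityMeasure μ] [IsProbabilityMeasure ν]
    {S : Set (α × β)} (hS : MeasurableSet S) :
    (μ.prod ν).real S = ∫ x, ν.real {y | (x, y) ∈ S} ∂μ := by
  rw [measureReal_def, Measure.prod_apply hS]
  exact (integral_toReal (measurable_measure_prodMk_left hS).aemeasurable
    (ae_of_all _ fun x => measure_lt_top _ _)).symm

/-- A natural number is zero or a successor. -/
def optionNatEquiv : Option ℕ ≃ ℕ where
  toFun o := o.elim 0 Nat.succ
  invFun n := n.casesOn none some
  left_inv o := by cases o <;> rfl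
  right_inv n := by cases n <;> rfl

/-- A site is the root or a site of the subtree of one of the daughters of the root. -/
def optionSiteEquiv (b : ℕ) : Option (Fin b × Site b) ≃ Site b where
  toFun o := o.elim [] fun p => p.1 :: p.2
  invFun σ := σ.casesOn none fun i τ => some (i, τ)
  left_inv o := by cases o <;> rfl
  right_inv σ := by cases σ <;> rfl

instance (b : ℕ) (ρ : Measure ℝ) [IsProbabilityMeasure ρ] :
    IsProbabilityMeasure (configLaw b ρ) := by
  unfold configLaw; infer_instance

/-- The configuration with value `p.1` at the root and `p.2 i` on the subtree of the `i`-th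
daughter of the root. -/
def graft {b : ℕ} (p : ℝ × (Fin b → Site b → ℝ)) : Site b → ℝ
  | [] => p.1
  | i :: σ => p.2 i σ

lemma measurable_graft {b : ℕ} : Measurable (graft (b := b)) := by
  refine measurable_pi_lambda _ fun σ => ?_
  cases σ <;> simp only [graft] <;> fun_prop

/-- Currying turns the i.i.d. family on the non-root sites into `b` independent copies of the whole
configuration. -/
lemma map_graft (b : ℕ) (ρ : Measure ℝ) [IsProbabilityMeasure ρ] :
    (ρ.prod (Measure.pi fun _ : Fin b => configLaw b ρ)).map graft = configLaw b ρ := by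
  have h := map_consAlong (optionSiteEquiv b) ρ
  have hcurry := Measure.map_prod_map ρ
    (Measure.infinitePi fun _ : Fin b => Measure.infinitePi fun _ : Site b => ρ)
    measurable_id (MeasurableEquiv.curry (Fin b) (Site b) ℝ).symm.measurable
  rw [Measure.map_id, Measure.infinitePi_map_curry_symm (fun (_ : Fin b) (_ : Site b) => ρ)]
    at hcurry
  rw [hcurry, Measure.map_map (measurable_consAlong _) (by fun_prop), Measure.infinitePi_eq_pi] at h
  unfold configLaw
  refine Eq.trans ?_ h
  congr 1
  ext p σ
  cases σ <;> rfl

lemma configLaw_real_eq_integral {b : ℕ} {ρ : Measure ℝ} [IsProbabilityMeasure ρ]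
    {A : Set (Site b → ℝ)} (hA : MeasurableSet A) :
    (configLaw b ρ).real A =
      ∫ x, (Measure.pi fun _ : Fin b => configLaw b ρ).real {Y | graft (x, Y) ∈ A} ∂ρ := by
  conv_lhs => rw [← map_graft]
  rw [map_measureReal_apply measurable_graft hA,
    measureReal_prod_eq_integral _ _ (measurable_graft hA)]
  rfl

lemma Q_succ' (b : ℕ) (X : ℕ → ℝ) (θ : ℝ) (n : ℕ) :
    Q b X θ (n + 1) = Q b (fun k => X (k + 1)) (X 0 + θ / b) n := by
  induction n with
  | zero => simp only [Q]; ring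
  | succ n ih => rw [Q, ih, Q]

lemma measurable_Q (b : ℕ) (θ : ℝ) (n : ℕ) : Measurable fun X => Q b X θ n := by
  induction n with
  | zero => simp only [Q]; fun_prop
  | succ n ih => simp only [Q]; fun_prop

lemma Z_eq_iter (b : ℕ) (ρ : Measure ℝ) [IsProbabilityMeasure ρ] (n : ℕ) (θ : ℝ) :
    Z b ρ n θ = iter b ρ id n θ := by
  have hmeas : ∀ n θ, MeasurableSet {X : ℕ → ℝ | ∀ k ≤ n, 1 ≤ Q b X θ k} := fun n θ => by
    simp only [Set.ofPred_forall]
    exact .iInter fun k => .iInter fun _ => measurableSet_le measurable_const (measurable_Q b θ k)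
  induction n generalizing θ with
  | zero =>
    simp only [Z, iter, Nat.le_zero, forall_eq, Q]
    split_ifs with h <;> simp [h]
  | succ n ih =>
    rcases lt_or_ge θ 1 with h | h
    · rw [iter_of_lt _ h, Z, show {X : ℕ → ℝ | ∀ k ≤ n + 1, 1 ≤ Q b X θ k} = ∅ from ?_,
        measureReal_empty]
      ext X
      simp only [Set.mem_ofPred_eq, Set.mem_empty_iff_false, iff_false]
      intro hX
      exact absurd (hX 0 (Nat.zero_le _)) (not_le.2 h)
    · rw [iter_succ_of_le _ h, id, Z, ← map_consAlong optionNatEquiv ρ,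
        map_measureReal_apply (measurable_consAlong _) (hmeas _ _),
        measureReal_prod_eq_integral _ _ (measurable_consAlong _ (hmeas _ _))]
      refine integral_congr_ae (ae_of_all _ fun x => ?_)
      dsimp only
      rw [← ih, Z]
      congr 1
      ext Y
      simp only [Set.mem_ofPred_eq, Set.mem_preimage]
      constructor
      · intro hY k hk
        have := hY (k + 1) (by omega)
        rw [Q_succ'] at this
        exact this
      · intro hY k hk
        cases k with
        | zero => exact h
        | succ k =>
          rw [Q_succ']
          exact hY k (by omega)

/-! ### Probabilities of active sites and of reaching a generation -/

section

variable {b : ℕ}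

lemma measurableSet_active_prod (σ : Site b) :
    MeasurableSet {p : ℝ × (Site b → ℝ) | Active σ p.1 p.2} := by
  induction σ with
  | nil =>
    simp only [Active]
    exact measurableSet_le measurable_const (by fun_prop)
  | cons i σ ih =>
    simp only [Active, Set.ofPred_and]
    refine (measurableSet_le measurable_const (by fun_prop)).inter ?_
    have hm : Measurable fun p : ℝ × (Site b → ℝ) =>
        (((p.2 [] + p.1) / b, fun τ => p.2 (i :: τ)) : ℝ × (Site b → ℝ)) := by fun_prop
    exact hm ih

lemma measurableSet_active (σ : Site b) (κ : ℝ) : MeasurableSet {X | Active σ κ X} :=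
  measurable_prodMk_left (measurableSet_active_prod σ)

lemma measurableSet_reaches (n : ℕ) (κ : ℝ) : MeasurableSet (reaches b n κ) := by
  have : reaches b n κ = ⋃ σ : Site b, ⋃ _ : σ.length = n, {X | Active σ κ X} := by
    ext X; simp [reaches]
  rw [this]
  exact .iUnion fun σ => .iUnion fun _ => measurableSet_active σ κ

variable {ρ : Measure ℝ} [IsProbabilityMeasure ρ]

lemma configLaw_real_active (σ : Site b) (κ : ℝ) :
    (configLaw b ρ).real {X | Active σ κ X} = ∫ x, iter b ρ id σ.length (x + κ) ∂ρ := by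
  induction σ generalizing κ with
  | nil =>
    rw [configLaw_real_eq_integral (measurableSet_active _ κ)]
    refine integral_congr_ae (ae_of_all _ fun x => ?_)
    simp only [Set.mem_ofPred_eq, Active, graft, List.length_nil, iter]
    split_ifs with h <;> simp [h]
  | cons i σ ih =>
    rw [configLaw_real_eq_integral (measurableSet_active _ κ)]
    refine integral_congr_ae (ae_of_all _ fun x => ?_)
    simp only [Set.mem_ofPred_eq, Active, graft, List.length_cons]
    rcases lt_or_ge (x + κ) 1 with h | h
    · simp [iter_of_lt _ h, not_le.2 h]
    · rw [iter_succ_of_le _ h, id, ← ih]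
      simp only [h, true_and]
      exact (measurePreserving_eval (fun _ : Fin b => configLaw b ρ) i).measureReal_preimage
        (measurableSet_active σ _).nullMeasurableSet

lemma configLaw_real_reaches (n : ℕ) (κ : ℝ) :
    (configLaw b ρ).real (reaches b n κ) = ∫ x, iter b ρ (atLeastOne b) n (x + κ) ∂ρ := by
  induction n generalizing κ with
  | zero =>
    rw [configLaw_real_eq_integral (measurableSet_reaches _ κ)]
    refine integral_congr_ae (ae_of_all _ fun x => ?_)
    simp only [reaches, List.length_eq_zero_iff, exists_eq_left, Set.mem_ofPred_eq, Active, graft,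
      iter]
    split_ifs with h <;> simp [h]
  | succ n ih =>
    rw [configLaw_real_eq_integral (measurableSet_reaches _ κ)]
    refine integral_congr_ae (ae_of_all _ fun x => ?_)
    dsimp only
    have hset : {Y : Fin b → Site b → ℝ | graft (x, Y) ∈ reaches b (n + 1) κ} =
        {Y | 1 ≤ x + κ ∧ ∃ i, Y i ∈ reaches b n ((x + κ) / b)} := by
      ext Y
      simp only [reaches, Set.mem_ofPred_eq]
      constructor
      · rintro ⟨_ | ⟨i, σ⟩, hσ, ha⟩
        · simp at hσ
        · exact ⟨ha.1, i, σ, by simpa using hσ, ha.2⟩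
      · rintro ⟨h, i, σ, hσ, ha⟩
        exact ⟨i :: σ, by simp [hσ], h, ha⟩
    rw [hset]
    rcases lt_or_ge (x + κ) 1 with h | h
    · simp [iter_of_lt _ h, not_le.2 h]
    · rw [iter_succ_of_le _ h, ← ih]
      simp only [h, true_and]
      have hcompl : {Y : Fin b → Site b → ℝ | ∃ i, Y i ∈ reaches b n ((x + κ) / b)} =
          (Set.univ.pi fun _ : Fin b => (reaches b n ((x + κ) / b))ᶜ)ᶜ := by
        ext Y; simp
      have hm := measurableSet_reaches (b := b) n ((x + κ) / b)
      rw [hcompl, probReal_compl_eq_one_sub (.univ_pi fun _ => hm.compl), measureReal_def,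
        Measure.pi_pi]
      simp [atLeastOne, ← measureReal_def, probReal_compl_eq_one_sub hm]

end

/-! ### Infinite avalanches and mean size -/

section

variable {b : ℕ} {ρ : Measure ℝ}

lemma MFlat.exists_bound (hρ : MFlat b ρ) :
    ∃ C : ℝ, 0 ≤ C ∧ ∀ a δ : ℝ, 0 ≤ δ → ρ.real (Set.Ico a (a + δ)) ≤ C * δ := by
  obtain ⟨φ, C, -, hφ, hρφ⟩ := hρ.bounded_density
  refine ⟨C, C.2, fun a δ hδ => ?_⟩
  have h : ρ (Set.Ico a (a + δ)) ≤ C * ENNReal.ofReal δ := by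
    rw [hρφ, withDensity_apply _ measurableSet_Ico]
    calc _ ≤ ∫⁻ _ in Set.Ico a (a + δ), (C : ℝ≥0∞) ∂(volume.restrict (Set.Icc (0 : ℝ) 1)) :=
          lintegral_mono_ae (ae_restrict_of_ae hφ)
      _ = C * (volume.restrict (Set.Icc (0 : ℝ) 1)) (Set.Ico a (a + δ)) := by
          rw [lintegral_const, Measure.restrict_apply_univ]
      _ ≤ C * volume (Set.Ico a (a + δ)) := by gcongr; exact Measure.restrict_le_self
      _ = _ := by rw [Real.volume_Ico, add_sub_cancel_left]
  refine (ENNReal.toReal_mono (by finiteness) h).trans_eq ?_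
  rw [ENNReal.toReal_mul, ENNReal.toReal_ofReal hδ, ENNReal.coe_toReal]

/-- Absolute continuity excludes an atom at `1`, so almost surely no site starts at the threshold
before `v` is added. -/
lemma MFlat.ae_mem_Ico (hρ : MFlat b ρ) : ∀ᵐ x ∂ρ, x ∈ Set.Ico (0 : ℝ) 1 := by
  obtain ⟨φ, C, -, -, hρφ⟩ := hρ.bounded_density
  have h : ∀ᵐ x ∂(volume.restrict (Set.Icc (0 : ℝ) 1)), x ∈ Set.Ico (0 : ℝ) 1 := by
    rw [← Measure.restrict_congr_set Ico_ae_eq_Icc]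
    exact ae_restrict_mem measurableSet_Ico
  rw [hρφ]
  exact (withDensity_absolutelyContinuous _ φ).ae_le h

variable [IsProbabilityMeasure ρ]

lemma MFlat.measureReal_Ici_pos (hρ : MFlat b ρ) : 0 < ρ.real (Set.Ici (1 - 1 / (b : ℝ))) :=
  ENNReal.toReal_pos (hρ.pos_mass.trans_le (measure_mono Set.Icc_subset_Ici_self)).ne'
    (measure_ne_top _ _)

lemma ae_avalanche_eq (hρ : MFlat b ρ) (v : ℝ) :
    ∀ᵐ X ∂(configLaw b ρ), avalanche b X v = {σ | Active σ v X} := by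
  have h : ∀ᵐ X ∂(configLaw b ρ), ∀ σ, X σ ∈ Set.Ico (0 : ℝ) 1 :=
    ae_all_iff.2 fun σ =>
      (measurePreserving_eval_infinitePi (fun _ : Site b => ρ) σ).quasiMeasurePreserving.ae
        hρ.ae_mem_Ico
  filter_upwards [h] with X hX
  exact avalanche_eq (fun σ => (hX σ).1) fun σ => (hX σ).2

lemma probInfinite_eq (hρ : MFlat b ρ) (v : ℝ) :
    probInfinite b ρ v = configLaw b ρ (⋂ n, reaches b n v) := by
  refine measure_congr ?_
  filter_upwards [ae_avalanche_eq hρ v] with X hX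
  refine propext ?_
  change (avalanche b X v).Infinite ↔ X ∈ ⋂ n, reaches b n v
  rw [hX, setOf_active_infinite_iff]

lemma tendsto_reaches (hρ : MFlat b ρ) (v : ℝ) :
    Tendsto (fun n => ENNReal.ofReal (∫ x, iter b ρ (atLeastOne b) n (x + v) ∂ρ)) atTop
      (𝓝 (probInfinite b ρ v)) := by
  rw [probInfinite_eq hρ]
  have h : ∀ n, ENNReal.ofReal (∫ x, iter b ρ (atLeastOne b) n (x + v) ∂ρ) =
      configLaw b ρ (reaches b n v) := fun n => by
    rw [← configLaw_real_reaches, ofReal_measureReal]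
  simp_rw [h]
  exact tendsto_measure_iInter_atTop (fun n => (measurableSet_reaches n v).nullMeasurableSet)
    (reaches_antitone v) ⟨0, measure_ne_top _ _⟩

lemma integral_iter_le {G : ℝ → ℝ} {L : ℝ} (hG : UnitLipschitz L G) (hρ : MFlat b ρ) (n : ℕ)
    (v : ℝ) : ∫ x, iter b ρ G n (x + v) ∂ρ ≤ iter b ρ G n (1 + v) := by
  have : ∫ x, iter b ρ G n (x + v) ∂ρ ≤ ∫ _, iter b ρ G n (1 + v) ∂ρ := by
    refine integral_mono_ae (integrable_iter hG n v) (integrable_const _) ?_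
    filter_upwards [hρ.ae_mem_Ico] with x hx
    exact iter_mono hG n (by linarith [hx.2])
  simpa using this

lemma probInfinite_eq_zero (hb : 1 < b) (hρ : MFlat b ρ)
    (hle : ∀ n, iter b ρ id n 1 ≤ (1 / (b : ℝ)) ^ n) {v : ℝ} (hv : 0 ≤ v) :
    probInfinite b ρ v = 0 := by
  obtain ⟨C, hC0, hC⟩ := hρ.exists_bound
  have h := ENNReal.tendsto_ofReal (tendsto_iter_zero hb hC0 hC hle v hv)
  rw [ENNReal.ofReal_zero] at h
  exact le_antisymm (le_of_tendsto_of_tendsto' (tendsto_reaches hρ v) h fun n =>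
    ENNReal.ofReal_le_ofReal (integral_iter_le (unitLipschitz_atLeastOne b) hρ n v)) zero_le

lemma probInfinite_pos (hb : 1 < b) (hρ : MFlat b ρ) {N : ℕ}
    (hN : (1 / (b : ℝ)) ^ N < iter b ρ id N 1) {v : ℝ} (hv : 1 - xStar ρ < v) :
    0 < probInfinite b ρ v := by
  obtain ⟨ε, hε, hεle⟩ := exists_iter_lower_bound hb hN
  -- The point `1 - 1/b` lies in the set by `pos_mass`, so the supremum can be approximated from
  -- within.
  have hne : {y : ℝ | y ∈ Set.Icc (0 : ℝ) 1 ∧ 0 < ρ (Set.Icc y 1)}.Nonempty := by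
    refine ⟨1 - 1 / b, ⟨?_, ?_⟩, hρ.pos_mass⟩
    · have : (1 : ℝ) / b ≤ 1 := (div_le_one (by positivity)).2 (by exact_mod_cast hb.le)
      linarith
    · have : (0 : ℝ) ≤ 1 / b := by positivity
      linarith
  obtain ⟨y, ⟨-, hy⟩, hyv⟩ := exists_lt_of_lt_csSup hne
    (show 1 - v < sSup {y : ℝ | y ∈ Set.Icc (0 : ℝ) 1 ∧ 0 < ρ (Set.Icc y 1)} by
      unfold xStar at hv; linarith)
  have hr : 0 < ρ.real (Set.Icc y 1) := ENNReal.toReal_pos hy.ne' (measure_ne_top _ _)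
  have hlow : ∀ n, ρ.real (Set.Icc y 1) * ε ≤
      ∫ x, iter b ρ (atLeastOne b) n (x + v) ∂ρ := by
    intro n
    have hG := unitLipschitz_atLeastOne b
    rw [← smul_eq_mul, ← integral_indicator_const _ measurableSet_Icc]
    refine integral_mono ((integrable_const _).indicator measurableSet_Icc)
      (integrable_iter hG n v) fun x => ?_
    dsimp only
    rw [Set.indicator_apply]
    split_ifs with hx
    · exact (hεle n).trans (iter_mono hG n (by linarith [hx.1]))
    · exact iter_nonneg hG n _
  refine lt_of_lt_of_le (ENNReal.ofReal_pos.2 (mul_pos hr hε)) ?_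
  exact ge_of_tendsto' (tendsto_reaches hρ v) fun n => ENNReal.ofReal_le_ofReal (hlow n)

lemma meanSize_eq_top (hρ : MFlat b ρ) {v : ℝ} (h : 0 < probInfinite b ρ v) :
    meanSize b ρ v = ∞ := by
  have hE : MeasurableSet (⋂ n, reaches b n v) := .iInter fun n => measurableSet_reaches n v
  refine top_unique ?_
  calc ∞ = ∫⁻ X, (⋂ n, reaches b n v).indicator (fun _ => ∞) X ∂(configLaw b ρ) := by
        rw [lintegral_indicator_const hE, ← probInfinite_eq hρ, ENNReal.top_mul h.ne']
    _ ≤ meanSize b ρ v := by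
        refine lintegral_mono_ae ?_
        filter_upwards [ae_avalanche_eq hρ v] with X hX
        by_cases hXE : X ∈ ⋂ n, reaches b n v
        · rw [hX, ((setOf_active_infinite_iff v X).2 hXE).encard_eq]
          exact le_top
        · rw [Set.indicator_of_notMem hXE]
          exact zero_le

lemma tsum_site_length (g : ℕ → ℝ≥0∞) :
    ∑' σ : Site b, g σ.length = ∑' n, (b : ℝ≥0∞) ^ n * g n := by
  rw [← (Equiv.sigmaFiberEquiv (List.length : Site b → ℕ)).tsum_eq, ENNReal.tsum_sigma']
  refine tsum_congr fun n => ?_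
  have : ∀ σ : {σ : Site b // σ.length = n},
      g ((Equiv.sigmaFiberEquiv (List.length : Site b → ℕ)) ⟨n, σ⟩).length = g n := fun σ => by
    simp [Equiv.sigmaFiberEquiv, σ.2]
  simp_rw [this]
  change ∑' _ : List.Vector (Fin b) n, g n = _
  simp [tsum_fintype]

lemma meanSize_eq (hρ : MFlat b ρ) (v : ℝ) :
    meanSize b ρ v = ∑' n, (b : ℝ≥0∞) ^ n *
      ENNReal.ofReal (∫ x, iter b ρ id n (x + v) ∂ρ) := by
  rw [← tsum_site_length, meanSize]
  calc _ = ∫⁻ X, ∑' σ : Site b, {X | Active σ v X}.indicator 1 X ∂(configLaw b ρ) := by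
        refine lintegral_congr_ae ?_
        filter_upwards [ae_avalanche_eq hρ v] with X hX
        rw [hX, ← ENNReal.tsum_set_one]
        exact tsum_subtype {σ | Active σ v X} fun _ => (1 : ℝ≥0∞)
    _ = _ := by
        rw [lintegral_tsum fun σ =>
          (measurable_one.indicator (measurableSet_active σ v)).aemeasurable]
        refine tsum_congr fun σ => ?_
        rw [lintegral_indicator_one (measurableSet_active σ v), ← configLaw_real_active,
          ofReal_measureReal]

lemma meanSize_lt_top (hb : 1 < b) (hρ : MFlat b ρ) {z : ℝ} (hz : 0 < z)
    (hle : ∀ n, iter b ρ id n 1 ≤ z ^ n) (hzb : z < 1 / b) {v : ℝ} (hv : 0 ≤ v) :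
    meanSize b ρ v < ∞ := by
  obtain ⟨C, hC0, hC⟩ := hρ.exists_bound
  obtain ⟨K, hK, hKb⟩ := exists_bound_mul_pow hb hC0 hC hz hle v hv
  have hb0 : (0 : ℝ) < b := by exact_mod_cast (by omega : 0 < b)
  have hsum : Summable fun n => K * (b * z) ^ n :=
    (summable_geometric_of_lt_one (by positivity) ((lt_div_iff₀' hb0).1 hzb)).mul_left K
  rw [meanSize_eq hρ]
  refine lt_of_le_of_lt (ENNReal.tsum_le_tsum fun n => ?_) hsum.tsum_ofReal_lt_top
  calc _ ≤ (b : ℝ≥0∞) ^ n * ENNReal.ofReal (K * z ^ n) := by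
        gcongr
        exact (integral_iter_le unitLipschitz_id hρ n v).trans (hKb n)
    _ = ENNReal.ofReal (K * (b * z) ^ n) := by
        rw [← ENNReal.ofReal_natCast, ← ENNReal.ofReal_pow hb0.le,
          ← ENNReal.ofReal_mul (by positivity), mul_pow]
        congr 1
        ring

end

end Avalanche

end

/-! ### Assembly -/

theorem theorem3p1 (b : ℕ) (hb : 1 < b) (ρ : Measure ℝ) [IsProbabilityMeasure ρ]
    (hρ : Avalanche.MFlat b ρ) :
    -- `z(ρ)` is well defined: the limit exists and is the same for all `θ ≥ 1`
    (∀ θ : ℝ, 1 ≤ θ →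
      Tendsto (fun n : ℕ => Avalanche.Z b ρ n θ ^ (1 / (n : ℝ))) atTop
        (𝓝 (Avalanche.zFun b ρ))) ∧
    -- no infinite avalanche for any `v`, exactly when `z(ρ) ≤ 1/b`
    (Avalanche.zFun b ρ ≤ 1 / (b : ℝ) ↔
      ∀ v : ℝ, 0 < v → Avalanche.probInfinite b ρ v = 0) ∧
    -- infinite avalanches above criticality, for every `v > 1 - x_⋆`
    (1 / (b : ℝ) < Avalanche.zFun b ρ →
      ∀ v : ℝ, 1 - Avalanche.xStar ρ < v → 0 < Avalanche.probInfinite b ρ v) ∧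
    -- no intermediate phase: the mean avalanche size changes at the same critical value
    (Avalanche.zFun b ρ < 1 / (b : ℝ) →
      ∀ v : ℝ, 0 < v → Avalanche.meanSize b ρ v < ∞) ∧
    (1 / (b : ℝ) < Avalanche.zFun b ρ →
      ∀ v : ℝ, 1 - Avalanche.xStar ρ < v → Avalanche.meanSize b ρ v = ∞) := by
  obtain ⟨C, hC0, hC⟩ := hρ.exists_bound
  obtain ⟨z, hz, hle, hlim⟩ := Avalanche.exists_rate (b := b) hρ.measureReal_Ici_pos
  have hb0 : (0 : ℝ) < b := by exact_mod_cast (by omega : 0 < b)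
  have hlimZ : ∀ θ : ℝ, 1 ≤ θ →
      Tendsto (fun n : ℕ => Avalanche.Z b ρ n θ ^ (1 / (n : ℝ))) atTop (𝓝 z) := by
    intro θ hθ
    simp_rw [Avalanche.Z_eq_iter]
    exact Avalanche.tendsto_rate hb hC0 hC hz hle hlim hθ
  have hzFun : Avalanche.zFun b ρ = z := (hlimZ 1 le_rfl).limUnder_eq
  have hsuper : 1 / (b : ℝ) < z → ∃ N, (1 / (b : ℝ)) ^ N < Avalanche.iter b ρ id N 1 := by
    intro h
    obtain ⟨N, hN, hN0⟩ :=
      ((hlim.eventually (lt_mem_nhds h)).and (eventually_ge_atTop 1)).exists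
    refine ⟨N, ?_⟩
    have := pow_lt_pow_left₀ hN (by positivity) (by omega : N ≠ 0)
    rwa [one_div (N : ℝ), Real.rpow_inv_natCast_pow
      (Avalanche.iter_nonneg Avalanche.unitLipschitz_id _ _) (by omega)] at this
  have hpos : 1 / (b : ℝ) < z →
      ∀ v : ℝ, 1 - Avalanche.xStar ρ < v → 0 < Avalanche.probInfinite b ρ v := by
    intro h v hv
    obtain ⟨N, hN⟩ := hsuper h
    exact Avalanche.probInfinite_pos hb hρ hN hv
  rw [hzFun]
  refine ⟨hlimZ, ⟨fun h v hv => ?_, fun h => ?_⟩, hpos, fun h v hv => ?_, fun h v hv => ?_⟩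
  · exact Avalanche.probInfinite_eq_zero hb hρ (fun n => (hle n).trans (by gcongr)) hv.le
  · by_contra hcon
    have hx : 0 ≤ Avalanche.xStar ρ := Real.sSup_nonneg fun y hy => hy.1.1
    -- Any `v > 1` would do, because `xStar ρ ≥ 0` makes it exceed `1 - xStar ρ`.
    exact (hpos (not_le.1 hcon) 2 (by linarith)).ne' (h 2 two_pos)
  · exact Avalanche.meanSize_lt_top hb hρ hz hle h hv.le
  · exact Avalanche.meanSize_eq_top hρ (hpos h v hv)
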